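/- Let $\mathbb{K}$ be a field of characteristic $0$ and let $S = \mathbb{K}[x_1,\dots,x_n]$. For $1 \le i < j \le n$ let $H_{i,j} \subset \mathbb{K}^n$ be the hyperplane $x_i = x_j$, and for $1 \le j \le n$ let $H_{0,j}$ be the hyperplane $x_j = 0$. A set $\mathcal{A}$ of hyperplanes $H_{i,j}$ with $0 \le i < j \le n$ is called a southwest arrangement if $H_{i,j} \in \mathcal{A}$ and $j > i+1$ imply $H_{i,j-1} \in \mathcal{A}$; it is essential if $\bigcap_{H \in \mathcal{A}} H = \{0\}$. Its $h$-sequence is $(h_1,\dots,h_n)$ with $h_j = |\mathcal{A} \cap \{H_{0,j}, H_{1,j}, \dots, H_{j-1,j}\}|$. Let $Q(\mathcal{A}) \in S$ be the product of linear forms $\alpha_H$ with $\ker \alpha_H = H$, one for each $H \in \mathcal{A}$ (it is determined up to a nonzero scalar). Let $\mathrm{Der}(S) = \bigoplus_{i=1}^n S\,\partial_i$ be the module of $\mathbb{K}$-linear derivations of $S$, let $\mathrm{Der}(\mathcal{A})$ be the submodule of all $\theta \in \mathrm{Der}(S)$ such that $Q(\mathcal{A})$ divides $\theta(Q(\mathcal{A}))$,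 and let $\mathfrak{i} : \mathrm{Der}(S) \to S$ be the $S$-linear map with $\mathfrak{i}(\partial_i) = 1$ for all $i$. The Solomon--Terao algebra is $\mathcal{ST}(\mathcal{A},\mathfrak{i}) = S / \mathfrak{i}(\mathrm{Der}(\mathcal{A}))$. Theorem. If $\mathcal{A}$ is an essential southwest arrangement in $\mathbb{K}^n$ with $h$-sequence $(h_1,\dots,h_n)$, then the monomials $x_1^{a_1}\cdots x_n^{a_n}$ with $0 \le a_i < h_i$ for all $i$ descend to a $\mathbb{K}$-basis of $\mathcal{ST}(\mathcal{A},\mathfrak{i})$. -/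

import Mathlib

namespace SolomonTerao

open MvPolynomial

section General

variable {K : Type*} [Field K] {n : ℕ}

/-- The linear polynomial `α(e₁) x₁ + ⋯ + α(eₙ) xₙ` attached to a linear functional `α` on `Kⁿ`. -/
noncomputable def linearPoly (α : Module.Dual K (Fin n → K)) : MvPolynomial (Fin n) K :=
  ∑ i, C (α (Pi.single i 1)) * X i

/-- `A` is a (central) hyperplane arrangement in `Kⁿ`: a finite set of linear subspaces of
codimension one. -/
def IsArrangement (A : Finset (Submodule K (Fin n → K))) : Prop :=
  ∀ H ∈ A, Module.finrank K ((Fin n → K) ⧸ H) = 1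

/-- The arrangement `A` is essential: its hyperplanes meet only in the origin. -/
def IsEssential (A : Finset (Submodule K (Fin n → K))) : Prop :=
  (⨅ H ∈ A, H) = ⊥

/-- `Q` is a defining polynomial of `A`: a product of linear forms, one for each `H ∈ A`,
with kernel `H`. (It is determined by `A` up to a nonzero scalar.) -/
def IsDefiningPolynomial (A : Finset (Submodule K (Fin n → K)))
    (Q : MvPolynomial (Fin n) K) : Prop :=
  ∃ α : Submodule K (Fin n → K) → Module.Dual K (Fin n → K),
    (∀ H ∈ A, LinearMap.ker (α H) = H) ∧ Q = ∏ H ∈ A, linearPoly (α H)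

theorem IsArrangement.exists_isDefiningPolynomial {A : Finset (Submodule K (Fin n → K))}
    (hA : IsArrangement A) : ∃ Q, IsDefiningPolynomial A Q := by
  classical
  have key : ∀ H : Submodule K (Fin n → K), H ∈ A →
      ∃ α : Module.Dual K (Fin n → K), LinearMap.ker α = H := by
    intro H hH
    have e : ((Fin n → K) ⧸ H) ≃ₗ[K] K :=
      LinearEquiv.ofFinrankEq _ _ (by rw [hA H hH, Module.finrank_self])
    exact ⟨e.toLinearMap ∘ₗ H.mkQ, by rw [LinearEquiv.ker_comp, Submodule.ker_mkQ]⟩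
  choose! α hα using key
  exact ⟨_, α, hα, rfl⟩

/-- The derivation module `Der(A)`: the derivations `θ` of `S = K[x₁, …, xₙ]` such that `Q(A)`
divides `θ(Q(A))`. Since `Q(A)` is defined up to a nonzero scalar, the condition is the same for
every choice of `Q(A)`. -/
noncomputable def derModule (A : Finset (Submodule K (Fin n → K))) :
    Submodule (MvPolynomial (Fin n) K)
      (Derivation K (MvPolynomial (Fin n) K) (MvPolynomial (Fin n) K)) where
  carrier := {θ | ∀ Q, IsDefiningPolynomial A Q → Q ∣ θ Q}
  add_mem' := fun ha hb Q hQ => by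
    simpa using dvd_add (ha Q hQ) (hb Q hQ)
  zero_mem' := fun Q _ => by simp
  smul_mem' := fun f θ hθ Q hQ => by
    simpa using Dvd.dvd.mul_left (hθ Q hQ) f

/-- The `S`-linear map `𝔠 : Der(S) → S` with `∂ᵢ ↦ cᵢ`. A derivation `θ` equals
`∑ᵢ θ(xᵢ) ∂ᵢ`, so its image is `∑ᵢ θ(xᵢ) cᵢ`. -/
noncomputable def derMap (c : Fin n → MvPolynomial (Fin n) K) :
    Derivation K (MvPolynomial (Fin n) K) (MvPolynomial (Fin n) K)
      →ₗ[MvPolynomial (Fin n) K] MvPolynomial (Fin n) K where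
  toFun θ := ∑ i, θ (X i) * c i
  map_add' θ η := by simp [add_mul, Finset.sum_add_distrib]
  map_smul' f θ := by simp [Finset.mul_sum, mul_assoc]

theorem derMap_pderiv (c : Fin n → MvPolynomial (Fin n) K) (i : Fin n) :
    derMap c (pderiv i) = c i := by
  classical
  simp [derMap, pderiv_X, Pi.single_apply]

/-- The Solomon–Terao ideal `𝔠_A = 𝔠(Der(A))` of `S`. -/
noncomputable def stIdeal (A : Finset (Submodule K (Fin n → K)))
    (c : Fin n → MvPolynomial (Fin n) K) : Ideal (MvPolynomial (Fin n) K) :=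
  (derModule A).map (derMap c)

/-- The Solomon–Terao algebra `ST(A, 𝔠) = S / 𝔠_A`, where `𝔠 : ∂ᵢ ↦ cᵢ`. -/
abbrev STAlgebra (A : Finset (Submodule K (Fin n → K)))
    (c : Fin n → MvPolynomial (Fin n) K) : Type _ :=
  MvPolynomial (Fin n) K ⧸ stIdeal A c

end General

section Southwest

variable (K : Type*) [Field K] {n : ℕ}

/-- The functionals `x₀ = 0, x₁, …, xₙ` on `Kⁿ`; here `x_{i+1}` is the coordinate with
index `i : Fin n`. -/
noncomputable def extCoord : Fin (n + 1) → Module.Dual K (Fin n → K) :=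
  Fin.cons 0 (fun i => LinearMap.proj i)

/-- The subspace `H_{i,j}` defined by `x_i = x_j`, where `x₀ = 0`. In particular `H_{0,j}` is the
coordinate hyperplane `x_j = 0`. -/
noncomputable def hyp (i j : Fin (n + 1)) : Submodule K (Fin n → K) :=
  LinearMap.ker (extCoord K i - extCoord K j)

variable (n) in
/-- The augmented braid arrangement `{H_{i,j} : 0 ≤ i < j ≤ n}` in `Kⁿ`. -/
def augmentedBraid : Set (Submodule K (Fin n → K)) :=
  {H | ∃ i j : Fin (n + 1), i < j ∧ H = hyp K i j}

variable {K}

/-- `A` is a southwest arrangement: a subset of the augmented braid arrangement such that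
`H_{i,j} ∈ A` and `j > i + 1` imply `H_{i,j-1} ∈ A` (below, `k = j - 1`). -/
structure IsSouthwest (A : Finset (Submodule K (Fin n → K))) : Prop where
  subset : (A : Set (Submodule K (Fin n → K))) ⊆ augmentedBraid K n
  closed : ∀ i k j : Fin (n + 1), i < k → (j : ℕ) = (k : ℕ) + 1 → hyp K i j ∈ A → hyp K i k ∈ A

theorem extCoord_injective : Function.Injective (extCoord K (n := n)) := by
  intro i j h
  induction i using Fin.cases with
  | zero =>
    induction j using Fin.cases with
    | zero => rfl
    | succ j => simpa [extCoord] using LinearMap.congr_fun h (Pi.single j 1)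
  | succ i =>
    induction j using Fin.cases with
    | zero => simpa [extCoord] using LinearMap.congr_fun h (Pi.single i 1)
    | succ j =>
      have := LinearMap.congr_fun h (Pi.single j 1)
      by_contra hij
      have hij' : i ≠ j := fun e => hij (by rw [e])
      simp [extCoord, hij'] at this

theorem IsSouthwest.isArrangement {A : Finset (Submodule K (Fin n → K))}
    (hA : IsSouthwest A) : IsArrangement A := by
  intro H hH
  obtain ⟨i, j, hij, rfl⟩ := hA.subset hH
  have hne : extCoord K i - extCoord K j ≠ 0 :=
    sub_ne_zero.2 fun h => hij.ne (extCoord_injective h)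
  have e := (extCoord K i - extCoord K j).quotKerEquivOfSurjective
    (LinearMap.surjective hne)
  exact e.finrank_eq.trans (Module.finrank_self K)

/-- The `h`-sequence: `h_j = |A ∩ {H_{0,j}, H_{1,j}, …, H_{j-1,j}}|` for `1 ≤ j ≤ n`. The index
`j : Fin n` stands for the coordinate number `j + 1`, which is `j.succ : Fin (n + 1)`. -/
noncomputable def hSeq (A : Finset (Submodule K (Fin n → K))) (j : Fin n) : ℕ :=
  ((A : Set (Submodule K (Fin n → K))) ∩ {H | ∃ i : Fin (n + 1), i < j.succ ∧ H = hyp K i j.succ}).ncard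

end Southwest

end SolomonTerao

/-! The derivations `basisDer` are triangular and generate the derivation module. Hence the
Solomon–Terao ideal is generated by n polynomials: the k-th is the sum over l ≥ k of the products of
x_l - x_i over the lower neighbours i of k, with an extra factor x_l if k is adjacent to the origin
(`IsDescribedBy.stIdeal_eq`).

The basis comes from deletion–contraction along the last hyperplane x_j = 0 of row 0. Contraction
merges j into the origin, so the induction runs over a larger family, with a set Z of merged
vertices. Let y be the j-th generator after deletion and g the generators other than the j-th, which
deletion does not change. Modulo g the j-th generator is x_j y (`exists_gen_succ_eq`), and modulo
x_j the family g becomes that of the contraction (`X_dvd_gen_sub_gen`). So the ideals are I = (g,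
x_j y), I' = (g, y) for the deletion and I'' = (g, x_j) for the contraction. The sequence 0 → S/I' →
S/I → S/I'' → 0, starting with multiplication by x_j, matches the splitting of the box into the
monomials prime to x_j and those divisible by x_j.

Injectivity on the left needs the first Koszul homology of (g, x_j) to vanish, so this vanishing is
carried along the induction (`OnlyKoszulSyzygies.update_mul`, `OnlyKoszulSyzygies.mem_of_mul_mem`).
At the start row 0 is empty: either every vertex is merged and the generators are the variables, or
the lowest unmerged vertex gives a nonzero constant, by characteristic 0. -/

namespace SolomonTerao

open MvPolynomial Matrix

/-! ### Families whose first Koszul homology vanishes. -/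

section Koszul

variable {R ι : Type*} [CommRing R] [Fintype ι]

/-- Every syzygy of the family `g` is a combination of the Koszul syzygies `g_l e_k - g_k e_l`,
i.e. the first Koszul homology of `g` vanishes. -/
def OnlyKoszulSyzygies (g : ι → R) : Prop :=
  ∀ c : ι → R, c ⬝ᵥ g = 0 → ∃ B : Matrix ι ι R, c = (B - Bᵀ) *ᵥ g

theorem OnlyKoszulSyzygies.of_mul_eq_one [DecidableEq ι] {g : ι → R} (hg : OnlyKoszulSyzygies g)
    {P Q : Matrix ι ι R} (h : P * Q = 1) : OnlyKoszulSyzygies (P *ᵥ g) := by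
  intro c hc
  obtain ⟨B, hB⟩ := hg (c ᵥ* P) (by rw [← hc, dotProduct_mulVec])
  have h' : Q * P = 1 := mul_eq_one_comm.1 h
  refine ⟨Qᵀ * B * Q, ?_⟩
  have h1 : Qᵀ * B * Q - (Qᵀ * B * Q)ᵀ = Qᵀ * (B - Bᵀ) * Q := by
    simp [Matrix.mul_sub, Matrix.sub_mul, Matrix.mul_assoc]
  rw [h1, mulVec_mulVec, Matrix.mul_assoc, h', Matrix.mul_one, ← mulVec_mulVec, ← hB,
    mulVec_transpose, vecMul_vecMul, h, vecMul_one]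

/-- The change of generators is the transvection 1 + u vᵀ, whose inverse is 1 - u vᵀ because v · u =
0. -/
theorem OnlyKoszulSyzygies.add_smul {g : ι → R} (hg : OnlyKoszulSyzygies g)
    {u v : ι → R} (h : v ⬝ᵥ u = 0) : OnlyKoszulSyzygies (g + (v ⬝ᵥ g) • u) := by
  classical
  have h2 : vecMulVec u v * vecMulVec u v = 0 := by
    rw [vecMulVec_mul_vecMulVec, h]; ext; simp [vecMulVec_apply]
  have := hg.of_mul_eq_one (P := 1 + vecMulVec u v) (Q := 1 - vecMulVec u v)
    (by rw [mul_sub, add_mul, add_mul, h2]; simp)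
  convert this using 1
  rw [add_mulVec, one_mulVec, vecMulVec_mulVec]
  ext; simp [mul_comm]

theorem dotProduct_koszul (B : Matrix ι ι R) (g : ι → R) : ((B - Bᵀ) *ᵥ g) ⬝ᵥ g = 0 := by
  rw [sub_mulVec, sub_dotProduct, mulVec_transpose, ← dotProduct_mulVec, dotProduct_comm, sub_self]

variable [DecidableEq ι]

theorem dotProduct_eq_add_sum_erase (c g : ι → R) (j : ι) :
    c ⬝ᵥ g = c j * g j + ∑ k ∈ Finset.univ.erase j, c k * g k :=
  (Finset.add_sum_erase _ _ (Finset.mem_univ j)).symm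

theorem dotProduct_update_right (c g : ι → R) (j : ι) (x : R) :
    c ⬝ᵥ Function.update g j x = c j * x + ∑ k ∈ Finset.univ.erase j, c k * g k := by
  rw [dotProduct_eq_add_sum_erase _ _ j, Function.update_self]
  congr 1
  exact Finset.sum_congr rfl fun k hk => by rw [Function.update_of_ne (Finset.ne_of_mem_erase hk)]

theorem OnlyKoszulSyzygies.update_mul {g : ι → R} {j : ι} {x y : R}
    (hx : OnlyKoszulSyzygies (Function.update g j x))
    (hy : OnlyKoszulSyzygies (Function.update g j y)) :
    OnlyKoszulSyzygies (Function.update g j (x * y)) := by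
  intro c hc
  rw [dotProduct_update_right] at hc
  -- Moving x from the generator to the coefficient turns c into a syzygy of (g, y).
  obtain ⟨B, hB⟩ := hy (Function.update c j (c j * x)) (by
    rw [dotProduct_update_right, Function.update_self, ← hc, mul_assoc]
    congr 1
    exact Finset.sum_congr rfl fun k hk => by
      rw [Function.update_of_ne (Finset.ne_of_mem_erase hk)])
  have hB' (k : ι) : Function.update c j (c j * x) k = (B k j - B j k) * y +
      ∑ l ∈ Finset.univ.erase j, (B k l - B l k) * g l := by
    have := congrFun hB k
    rw [this, mulVec, dotProduct_update_right]; rfl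
  have hj := hB' j
  rw [Function.update_self, sub_self, zero_mul, zero_add] at hj
  -- The diagonal of B - Bᵀ vanishes, so row j of `hB` contains no y and reads as a syzygy of (g, x)
  -- with j-th entry c_j.
  obtain ⟨D, hD⟩ := hx (Function.update (fun k => B k j - B j k) j (c j)) (by
    rw [dotProduct_update_right, Function.update_self, hj, ← Finset.sum_add_distrib]
    refine Finset.sum_eq_zero fun k hk => ?_
    rw [Function.update_of_ne (Finset.ne_of_mem_erase hk)]
    ring)
  have hD' (k : ι) : Function.update (fun k => B k j - B j k) j (c j) k = (D k j - D j k) * x +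
      ∑ l ∈ Finset.univ.erase j, (D k l - D l k) * g l := by
    have := congrFun hD k
    rw [this, mulVec, dotProduct_update_right]; rfl
  -- Obtained by substituting the expression of B k j - B j k from `hD'` into `hB'`.
  refine ⟨Matrix.of fun k l => if k = j ∨ l = j then D k l else B k l + y * D k l, ?_⟩
  ext k
  rw [mulVec, dotProduct_update_right]
  by_cases hk : k = j
  · subst hk
    have := hD' k
    rw [Function.update_self] at this
    simp [this]
  · have h1 := hB' k
    have h2 := hD' k
    rw [Function.update_of_ne hk] at h1 h2
    rw [h1, h2, add_mul, Finset.sum_mul, add_assoc, ← Finset.sum_add_distrib]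
    simp only [Matrix.sub_apply, transpose_apply, of_apply, hk, true_or, or_true, if_true, false_or]
    congr 1
    · ring
    · refine Finset.sum_congr rfl fun l hl => ?_
      simp only [Finset.ne_of_mem_erase hl, or_false, if_false]
      ring

theorem OnlyKoszulSyzygies.of_isUnit {g : ι → R} {j : ι} (h : IsUnit (g j)) :
    OnlyKoszulSyzygies g := by
  intro c hc
  obtain ⟨u, hu⟩ := h.exists_left_inv
  -- Column j produces the entries c_k with k ≠ j; the entry c_j is then forced by the relation c ·
  -- g = 0.
  refine ⟨Matrix.of fun k l => if l = j ∧ k ≠ j then c k * u else 0, ?_⟩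
  ext k
  rw [mulVec, dotProduct_eq_add_sum_erase _ _ j]
  rw [dotProduct_eq_add_sum_erase _ _ j] at hc
  by_cases hk : k = j
  · subst hk
    have : ∀ l ∈ Finset.univ.erase k, l ≠ k := fun l => Finset.ne_of_mem_erase
    rw [Finset.sum_congr rfl (g := fun l => -u * (c l * g l)), ← Finset.mul_sum]
    · simp only [Matrix.sub_apply, sub_self, zero_mul, transpose_apply, zero_add]
      linear_combination u * hc - c k * hu
    · intro l hl
      simp [this l hl]; ring
  · rw [Finset.sum_eq_zero]
    · simp [hk]
      linear_combination - c k * hu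
    · intro l hl
      simp [hk, Finset.ne_of_mem_erase hl]

/-- If the syzygies of `(g, x)` are Koszul, then `x` is a nonzerodivisor modulo `g`. -/
theorem OnlyKoszulSyzygies.mem_of_mul_mem {g : ι → R} {j : ι} {x y p : R}
    (hx : OnlyKoszulSyzygies (Function.update g j x))
    (hp : x * p ∈ Ideal.span (Set.range (Function.update g j (x * y)))) :
    p ∈ Ideal.span (Set.range (Function.update g j y)) := by
  rw [Ideal.mem_span_range_iff_exists_fun] at hp ⊢
  obtain ⟨c, hc⟩ := hp
  change c ⬝ᵥ _ = _ at hc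
  rw [dotProduct_update_right] at hc
  -- Since the diagonal of B - Bᵀ is zero, the j-th entry c_j y - p of this syzygy is a combination
  -- of the g_k with k ≠ j.
  obtain ⟨B, hB⟩ := hx (Function.update c j (c j * y - p)) (by
    rw [dotProduct_update_right, Function.update_self, Finset.sum_congr rfl
      (g := fun l => c l * g l)]
    · linear_combination hc
    · intro k hk
      rw [Function.update_of_ne (Finset.ne_of_mem_erase hk)])
  have h := congrFun hB j
  rw [Function.update_self, mulVec, dotProduct_update_right] at h
  refine ⟨Function.update (-(B - Bᵀ) j) j (c j), ?_⟩
  change _ ⬝ᵥ _ = _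
  rw [dotProduct_update_right, Function.update_self, Finset.sum_congr rfl
      (g := fun l => - ((B - Bᵀ) j l * g l)), Finset.sum_neg_distrib]
  · simp only [Matrix.sub_apply, transpose_apply, sub_self, zero_mul, zero_add] at h ⊢
    rw [← h]
    ring
  · intro k hk
    rw [Function.update_of_ne (Finset.ne_of_mem_erase hk), Pi.neg_apply, neg_mul]

end Koszul

theorem mem_span_X_image_of_X_mul_mem {σ K : Type*} [CommSemiring K] {s : Set σ} {t : σ}
    (ht : t ∉ s) {p : MvPolynomial σ K}
    (hp : X t * p ∈ Ideal.span (X '' s : Set (MvPolynomial σ K))) :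
    p ∈ Ideal.span (X '' s : Set (MvPolynomial σ K)) := by
  rw [mem_ideal_span_X_image] at hp ⊢
  intro m hm
  obtain ⟨i, hi, h⟩ := hp (Finsupp.single t 1 + m) (by
    rw [mem_support_iff, coeff_X_mul]; exact mem_support_iff.1 hm)
  refine ⟨i, hi, ?_⟩
  have : t ≠ i := fun h => ht (h ▸ hi)
  simpa [Finsupp.single_apply, this] using h

theorem onlyKoszulSyzygies_X (K : Type*) [CommRing K] (n : ℕ) :
    OnlyKoszulSyzygies (X : Fin n → MvPolynomial (Fin n) K) := by
  -- Induction on the support: the last coefficient lies in the ideal of the earlier variables, so a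
  -- Koszul syzygy removes it without creating later ones.
  have key : ∀ t ≤ n, ∀ c : Fin n → MvPolynomial (Fin n) K, c ⬝ᵥ X = 0 →
      (∀ k : Fin n, t ≤ k → c k = 0) → ∃ B : Matrix (Fin n) (Fin n) (MvPolynomial (Fin n) K),
        c = (B - Bᵀ) *ᵥ X := by
    intro t
    induction t with
    | zero => exact fun _ c _ h => ⟨0, by ext1 k; simp [h k (Nat.zero_le _)]⟩
    | succ t ih =>
      intro ht c hc h
      let t' : Fin n := ⟨t, ht⟩
      have hmem : c t' ∈ Ideal.span (X '' (Finset.univ.filter (· < t') : Finset (Fin n)) :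
          Set (MvPolynomial (Fin n) K)) := by
        refine mem_span_X_image_of_X_mul_mem (t := t') (by simp) ?_
        rw [dotProduct_eq_add_sum_erase _ _ t'] at hc
        rw [mul_comm, eq_neg_of_add_eq_zero_left hc]
        refine neg_mem (sum_mem fun k hk => ?_)
        rcases lt_or_gt_of_ne (Finset.ne_of_mem_erase hk) with hlt | hlt
        · exact Ideal.mul_mem_left _ _ (Ideal.subset_span ⟨k, by simpa using hlt, rfl⟩)
        · rw [h k (Nat.succ_le_of_lt hlt), zero_mul]; exact zero_mem _
      obtain ⟨b₀, hb₀⟩ := (Submodule.mem_span_image_finset_iff_exists_fun' _).1 hmem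
      let b : Fin n → MvPolynomial (Fin n) K := fun k => if k < t' then b₀ k else 0
      have hb : b ⬝ᵥ X = c t' := by
        rw [← hb₀, Finset.sum_filter]
        exact Finset.sum_congr rfl fun k _ => by simp [b]
      let D := vecMulVec (Pi.single t' 1) b
      have hD : (D - Dᵀ) *ᵥ X = (c t') • Pi.single t' 1 - (X t' : MvPolynomial (Fin n) K) • b := by
        simp only [D, sub_mulVec, transpose_vecMulVec, vecMulVec_mulVec, hb]
        ext1 k; simp [mul_comm]
      obtain ⟨B, hB⟩ := ih (Nat.le_of_succ_le ht) (c - (D - Dᵀ) *ᵥ X)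
        (by rw [sub_dotProduct, hc, dotProduct_koszul, sub_self]) (by
          intro k hk
          rw [hD]
          rcases eq_or_lt_of_le hk with hk | hk
          · obtain rfl : t' = k := Fin.ext hk
            simp [b]
          · have h1 : ¬ k < t' := by simpa [t', Fin.lt_def] using hk.le
            have h2 : k ≠ t' := fun h => by simp [h, t'] at hk
            simp [b, h1, h2, h k hk])
      refine ⟨B + D, ?_⟩
      rw [sub_eq_iff_eq_add.1 hB, ← add_mulVec, transpose_add]
      congr 1
      abel
  exact fun c hc => key n le_rfl c hc fun k hk => absurd k.2 (by omega)

/-! ### Monomial bases indexed by boxes of exponents. -/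

section Box

variable {K : Type*} [Field K] {n : ℕ}

/-- The exponents `a` with `aᵢ < hᵢ` for all `i`. -/
def box (h : Fin n → ℕ) : Set (Fin n →₀ ℕ) := {a | ∀ i, a i < h i}

/-- The monomials with exponents in the box of `h` descend to a basis of the quotient by `I`. -/
def IsBoxBasis (h : Fin n → ℕ) (I : Ideal (MvPolynomial (Fin n) K)) : Prop :=
  IsCompl (restrictSupport K (box h)) (I.restrictScalars K)

theorem isBoxBasis_top {h : Fin n → ℕ} {j : Fin n} (hj : h j = 0) :
    IsBoxBasis h (⊤ : Ideal (MvPolynomial (Fin n) K)) := by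
  have : box h = ∅ := Set.eq_empty_of_forall_notMem fun a ha => by simpa [hj] using ha j
  rw [IsBoxBasis, this, Submodule.restrictScalars_top]
  have h0 : restrictSupport K (∅ : Set (Fin n →₀ ℕ)) = ⊥ := by
    rw [eq_bot_iff]
    intro p hp
    simpa [mem_restrictSupport_iff] using hp
  rw [h0]
  exact isCompl_bot_top

theorem isBoxBasis_span_X :
    IsBoxBasis (fun _ => 1) (Ideal.span (Set.range (X : Fin n → MvPolynomial (Fin n) K))) := by
  have hbox : box (fun _ : Fin n => 1) = {0} := by
    ext a; simp [box, Finsupp.ext_iff]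
  rw [← Set.image_univ]
  constructor
  · rw [Submodule.disjoint_def]
    intro p hp hI
    rw [Submodule.restrictScalars_mem, mem_ideal_span_X_image] at hI
    rw [mem_restrictSupport_iff, hbox] at hp
    rw [← support_eq_empty]
    refine Finset.eq_empty_of_forall_notMem fun m hm => ?_
    obtain ⟨i, -, hi⟩ := hI m hm
    exact hi (by rw [hp hm]; rfl)
  · rw [codisjoint_iff, eq_top_iff]
    intro p _
    have : p = C (coeff 0 p) + (p - C (coeff 0 p)) := by ring
    rw [this]
    refine Submodule.add_mem_sup ?_ ?_
    · rw [C_apply, monomial_mem_restrictSupport, hbox]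
      exact Or.inl rfl
    · rw [Submodule.restrictScalars_mem, mem_ideal_span_X_image]
      intro m hm
      by_contra! h
      have : m = 0 := Finsupp.ext fun i => h i trivial
      simp [this, mem_support_iff] at hm

theorem exists_eq_add_X_mul {h : Fin n → ℕ} {j : Fin n} {q : MvPolynomial (Fin n) K}
    (hq : q ∈ restrictSupport K (box h)) :
    ∃ q₀ ∈ restrictSupport K (box (Function.update h j 1)),
      ∃ q₁ ∈ restrictSupport K (box (Function.update h j (h j - 1))), q = q₀ + X j * q₁ := by
  rw [restrictSupport_eq_span] at hq
  induction hq using Submodule.span_induction with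
  | mem q hq =>
    obtain ⟨a, ha, rfl⟩ := hq
    by_cases haj : a j = 0
    · refine ⟨monomial a 1, ?_, 0, zero_mem _, by simp⟩
      rw [monomial_mem_restrictSupport]
      refine Or.inl fun i => ?_
      rcases eq_or_ne i j with rfl | hij
      · simp [haj]
      · simpa [hij] using ha i
    · refine ⟨0, zero_mem _, monomial (a - Finsupp.single j 1) 1, ?_, ?_⟩
      · rw [monomial_mem_restrictSupport]
        refine Or.inl fun i => ?_
        have := ha i
        rcases eq_or_ne i j with rfl | hij
        · simp; omega
        · simpa [hij, Finsupp.single_apply, hij.symm] using ha i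
      · rw [X, monomial_mul, zero_add, one_mul, add_tsub_cancel_of_le]
        rw [Finsupp.single_le_iff]; omega
  | zero => exact ⟨0, zero_mem _, 0, zero_mem _, by simp⟩
  | add p q _ _ hp hq =>
    obtain ⟨p₀, hp₀, p₁, hp₁, rfl⟩ := hp
    obtain ⟨q₀, hq₀, q₁, hq₁, rfl⟩ := hq
    exact ⟨_, add_mem hp₀ hq₀, _, add_mem hp₁ hq₁, by ring⟩
  | smul c p _ hp =>
    obtain ⟨p₀, hp₀, p₁, hp₁, rfl⟩ := hp
    exact ⟨_, Submodule.smul_mem _ c hp₀, _, Submodule.smul_mem _ c hp₁, by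
      rw [smul_add, mul_smul_comm]⟩

theorem X_mul_mem_restrictSupport_box {h : Fin n → ℕ} {j : Fin n} {q : MvPolynomial (Fin n) K}
    (hq : q ∈ restrictSupport K (box (Function.update h j (h j - 1)))) :
    X j * q ∈ restrictSupport K (box h) := by
  rw [mem_restrictSupport_iff] at *
  rw [support_X_mul]
  intro a ha
  obtain ⟨b, hb, rfl⟩ := Finset.mem_map.1 ha
  intro i
  have := hq hb i
  rcases eq_or_ne i j with rfl | hij
  · simp at this ⊢; omega
  · simpa [hij, Finsupp.single_apply, hij.symm] using this

/-- The box bases of `S/I'` and `S/I''` combine along an exact sequence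
`0 → S/I' → S/I → S/I'' → 0` whose first map is the multiplication by `X j`. -/
theorem IsBoxBasis.of_exact {h : Fin n → ℕ} {j : Fin n} (hj : h j ≠ 0)
    {I I' I'' : Ideal (MvPolynomial (Fin n) K)}
    (h' : IsBoxBasis (Function.update h j (h j - 1)) I')
    (h'' : IsBoxBasis (Function.update h j 1) I'')
    (hI' : ∀ p, X j * p ∈ I ↔ p ∈ I') (hI'' : I'' = I ⊔ Ideal.span {X j}) :
    IsBoxBasis h I := by
  constructor
  · rw [Submodule.disjoint_def]
    intro q hq hqI
    rw [Submodule.restrictScalars_mem] at hqI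
    obtain ⟨q₀, hq₀, q₁, hq₁, rfl⟩ := exists_eq_add_X_mul (j := j) hq
    have hX : X j * q₁ ∈ I'' :=
      hI'' ▸ Ideal.mem_sup_right (Ideal.mul_mem_right _ _ (Ideal.mem_span_singleton_self _))
    have h0 : q₀ = 0 := Submodule.disjoint_def.1 h''.disjoint _ hq₀
      ((Ideal.add_mem_iff_left _ hX).1 (hI'' ▸ Ideal.mem_sup_left hqI))
    rw [h0, zero_add] at hqI ⊢
    rw [Submodule.disjoint_def.1 h'.disjoint _ hq₁ ((hI' _).1 hqI), mul_zero]
  · rw [codisjoint_iff, eq_top_iff]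
    intro p _
    have hle : box (Function.update h j 1) ⊆ box h := by
      intro a ha i
      have := ha i
      rcases eq_or_ne i j with rfl | hij
      · simp at this; omega
      · simpa [hij] using this
    have hp : p ∈ restrictSupport K (box (Function.update h j 1)) ⊔ I''.restrictScalars K := by
      rw [h''.sup_eq_top]; trivial
    obtain ⟨q₀, hq₀, r, hr, rfl⟩ := Submodule.mem_sup.1 hp
    rw [Submodule.restrictScalars_mem, hI'', Submodule.mem_sup] at hr
    obtain ⟨i, hi, s, hs, rfl⟩ := hr
    obtain ⟨s, rfl⟩ := Ideal.mem_span_singleton.1 hs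
    have hs' : s ∈ restrictSupport K (box (Function.update h j (h j - 1))) ⊔
        I'.restrictScalars K := by
      rw [h'.sup_eq_top]; trivial
    obtain ⟨q₁, hq₁, r, hr, rfl⟩ := Submodule.mem_sup.1 hs'
    have : q₀ + (i + X j * (q₁ + r)) = (q₀ + X j * q₁) + (i + X j * r) := by ring
    rw [this]
    exact Submodule.add_mem_sup
      (add_mem (restrictSupport_mono _ hle hq₀) (X_mul_mem_restrictSupport_box hq₁))
      (add_mem hi ((hI' _).2 hr) : i + X j * r ∈ I)

theorem IsBoxBasis.exists_basis {h : Fin n → ℕ} {I : Ideal (MvPolynomial (Fin n) K)}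
    (hI : IsBoxBasis h I) :
    ∃ b : Module.Basis {a : Fin n →₀ ℕ // ∀ i, a i < h i} K (MvPolynomial (Fin n) K ⧸ I),
      ∀ a, b a = Ideal.Quotient.mk I (monomial a.1 1) := by
  let e : restrictSupport K (box h) ≃ₗ[K] MvPolynomial (Fin n) K ⧸ I :=
    (Submodule.quotientEquivOfIsCompl _ _ hI.symm).symm ≪≫ₗ Submodule.Quotient.restrictScalarsEquiv K I
  let b := (basisRestrictSupport K (box h)).map e
  have hb (a : box h) : b a = Ideal.Quotient.mk I (monomial a.1 1) := by
    have : ((basisRestrictSupport K (box h)) a : MvPolynomial (Fin n) K) = monomial a.1 1 := by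
      have : basisRestrictSupport K (box h) a =
          ⟨monomial a.1 1, (monomial_mem_restrictSupport K).2 (Or.inl a.2)⟩ := by
        rw [Module.Basis.apply_eq_iff]
        ext i
        change coeff i.1 (monomial a.1 1) = _
        classical
        simp [coeff_monomial, Finsupp.single_apply, Subtype.ext_iff]
      rw [this]
    rw [Module.Basis.map_apply, ← this]
    rfl
  exact ⟨b, hb⟩

end Box

/-! ### Ideals under changes of one generator and under transvections. -/

section Span

variable {R ι : Type*} [CommRing R]

theorem dotProduct_mem_span_range [Fintype ι] (v g : ι → R) : v ⬝ᵥ g ∈ Ideal.span (Set.range g) :=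
  sum_mem fun k _ => Ideal.mul_mem_left _ _ (Ideal.subset_span ⟨k, rfl⟩)

theorem span_range_add_smul [Fintype ι] {u v : ι → R} (h : v ⬝ᵥ u = 0) (g : ι → R) :
    Ideal.span (Set.range (g + (v ⬝ᵥ g) • u)) = Ideal.span (Set.range g) := by
  have key (g u : ι → R) :
      Ideal.span (Set.range (g + (v ⬝ᵥ g) • u)) ≤ Ideal.span (Set.range g) := by
    rw [Ideal.span_le]
    rintro _ ⟨k, rfl⟩
    exact add_mem (Ideal.subset_span ⟨k, rfl⟩)
      (Ideal.mul_mem_right _ _ (dotProduct_mem_span_range v g))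
  refine le_antisymm (key g u) ?_
  have h' : g = (g + (v ⬝ᵥ g) • u) + (v ⬝ᵥ (g + (v ⬝ᵥ g) • u)) • (-u) := by
    rw [dotProduct_add, dotProduct_smul, h]
    simp
  conv_lhs => rw [h']
  exact key _ _

variable [DecidableEq ι]

theorem span_range_update_le {g : ι → R} {j : ι} {x : R} {I : Ideal R} (hx : x ∈ I)
    (hg : ∀ k, k ≠ j → g k ∈ I) : Ideal.span (Set.range (Function.update g j x)) ≤ I := by
  rw [Ideal.span_le]
  rintro _ ⟨k, rfl⟩
  rcases eq_or_ne k j with rfl | hk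
  · simpa using hx
  · simpa [hk] using hg k hk

theorem self_mem_span_range_update (g : ι → R) (j : ι) (x : R) :
    x ∈ Ideal.span (Set.range (Function.update g j x)) :=
  Ideal.subset_span ⟨j, by simp⟩

theorem apply_mem_span_range_update (g : ι → R) {j k : ι} (x : R) (h : k ≠ j) :
    g k ∈ Ideal.span (Set.range (Function.update g j x)) :=
  Ideal.subset_span ⟨k, by simp [h]⟩

theorem span_range_update_eq_sup (g : ι → R) (j : ι) (x y : R) :
    Ideal.span (Set.range (Function.update g j x)) =
      Ideal.span (Set.range (Function.update g j (x * y))) ⊔ Ideal.span {x} := by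
  apply le_antisymm
  · exact span_range_update_le (Ideal.mem_sup_right (Ideal.mem_span_singleton_self x))
      fun k hk => Ideal.mem_sup_left (apply_mem_span_range_update g _ hk)
  · refine sup_le (span_range_update_le (Ideal.mul_mem_right _ _
      (self_mem_span_range_update g j x)) fun k hk => apply_mem_span_range_update g _ hk) ?_
    rw [Ideal.span_singleton_le_iff_mem]
    exact self_mem_span_range_update g j x

theorem mul_mem_span_range_update {g : ι → R} {j : ι} {x y p : R}
    (hp : p ∈ Ideal.span (Set.range (Function.update g j y))) :
    x * p ∈ Ideal.span (Set.range (Function.update g j (x * y))) := by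
  have : Ideal.span (Set.range (Function.update g j y)) ≤
      Submodule.comap (LinearMap.mulLeft R x)
        (Ideal.span (Set.range (Function.update g j (x * y)))) :=
    span_range_update_le (self_mem_span_range_update g j (x * y))
      fun k hk => Ideal.mul_mem_left _ x (apply_mem_span_range_update g _ hk)
  exact this hp

end Span

/-! ### The explicit generators and their relations. -/

section Generators

variable {K : Type*} [Field K] {n : ℕ} (m : Fin n → ℕ) (Z : Finset (Fin n)) (M : ℕ)

/-- The lower neighbours, outside of `Z`, of the vertex `k`, where `i < k` are adjacent if
`k < m i`. -/
def lowerNbrs (k : ℕ) : Finset (Fin n) := {i | (i : ℕ) < k ∧ i ∉ Z ∧ k < m i}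

variable {m Z M} in
theorem mem_lowerNbrs {k : ℕ} {i : Fin n} :
    i ∈ lowerNbrs m Z k ↔ (i : ℕ) < k ∧ i ∉ Z ∧ k < m i := by
  simp [lowerNbrs]

/-- The vertices outside of `Z` that are at least `k`. -/
def upper (k : ℕ) : Finset (Fin n) := {l | k ≤ (l : ℕ) ∧ l ∉ Z}

variable {Z} in
theorem mem_upper {k : ℕ} {l : Fin n} : l ∈ upper Z k ↔ k ≤ (l : ℕ) ∧ l ∉ Z := by
  simp [upper]

variable (K) in
/-- The generators of the Solomon–Terao ideal of the southwest arrangement in which the vertices in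
`Z` are contracted to the origin, two of the other vertices `i < k` are adjacent if `k < m i`, and
`k` is adjacent to the origin if `k < M`. A contracted vertex contributes its coordinate. -/
noncomputable def gen (k : Fin n) : MvPolynomial (Fin n) K :=
  if k ∈ Z then X k else
    ∑ l ∈ upper Z k,
      (if (k : ℕ) < M then X l else 1) * ∏ i ∈ lowerNbrs m Z k, (X l - X i)

/-- The number of hyperplanes joining `k` to a lower vertex; it is set to `1` if `k` is
contracted. -/
def height (k : Fin n) : ℕ :=
  if k ∈ Z then 1 else (if (k : ℕ) < M then 1 else 0) + (lowerNbrs m Z k).card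

/-- This is the southwest condition: rows are intervals, so from k to k + 1 old neighbours may be
lost and only k itself can be new. -/
theorem lowerNbrs_succ_subset_insert (k : Fin n) :
    lowerNbrs m Z (k + 1) ⊆ insert k (lowerNbrs m Z k) := by
  intro i
  simp only [Finset.mem_insert, mem_lowerNbrs, Fin.ext_iff]
  grind

theorem lowerNbrs_succ_subset {k : Fin n} (hk : k ∈ Z) :
    lowerNbrs m Z (k + 1) ⊆ lowerNbrs m Z k := by
  intro i hi
  have := lowerNbrs_succ_subset_insert m Z k hi
  rw [Finset.mem_insert] at this
  rcases this with rfl | h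
  · exact absurd hk (mem_lowerNbrs.1 hi).2.1
  · exact h

variable {m Z M}

theorem sum_upper_eq_add {R : Type*} [AddCommMonoid R] {k : Fin n} (hk : k ∉ Z)
    (f : Fin n → R) :
    ∑ l ∈ upper Z k, f l =
      f k + ∑ l ∈ upper Z (k + 1), f l := by
  rw [← Finset.sum_insert (by simp [mem_upper])]
  congr 1
  ext l
  simp only [Finset.mem_insert, mem_upper, Fin.ext_iff]
  have : l = k → l ∉ Z := fun h => h ▸ hk
  rw [Fin.ext_iff] at this
  grind

theorem gen_of_notMem {k : Fin n} (hk : k ∉ Z) :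
    gen K m Z M k = ∑ l ∈ upper Z k,
      (if (k : ℕ) < M then X l else 1) * ∏ i ∈ lowerNbrs m Z k, (X l - X i) := by
  rw [gen, if_neg hk]

/-- Descending induction on k. Write F = f q with f the product over the neighbours of k.
Subtracting q(x_k) times the k-th generator leaves f (q - q(x_k)), which vanishes at x_k and is
divisible by f (t - x_k), hence by the product for k + 1. -/
theorem sum_eval_mem_span (k : ℕ) (hk : M ≤ k) (F : Polynomial (MvPolynomial (Fin n) K))
    (hF : ∏ i ∈ lowerNbrs m Z k, (Polynomial.X - Polynomial.C (X i)) ∣ F) :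
    ∑ l ∈ upper Z k, F.eval (X l) ∈
      Ideal.span (gen K m Z M '' {l : Fin n | k ≤ l}) := by
  induction hd : n - k generalizing k F with
  | zero =>
    rw [Finset.sum_eq_zero]
    · exact zero_mem _
    · intro l hl
      have := l.2
      rw [mem_upper] at hl
      omega
  | succ d ih =>
    let k' : Fin n := ⟨k, by omega⟩
    have hle : Ideal.span (gen K m Z M '' {l : Fin n | k + 1 ≤ l}) ≤
        Ideal.span (gen K m Z M '' {l : Fin n | k ≤ l}) :=
      Ideal.span_mono (Set.image_mono fun l (hl : k + 1 ≤ l) => (by omega : k ≤ l))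
    by_cases hZ : k' ∈ Z
    · have := ih (k + 1) (by omega) F ((Finset.prod_dvd_prod_of_subset _ _ _
        (lowerNbrs_succ_subset m Z hZ)).trans hF) (by omega)
      convert hle this using 2
      ext l
      have h : l = k' → l ∈ Z := fun h => h ▸ hZ
      simp only [Fin.ext_iff, k'] at h
      simp only [mem_upper]
      grind
    · obtain ⟨q, rfl⟩ := hF
      set f : Polynomial (MvPolynomial (Fin n) K) :=
        ∏ i ∈ lowerNbrs m Z k, (Polynomial.X - Polynomial.C (X i)) with hf
      have h1 := ih (k + 1) (by omega) (f * (q - Polynomial.C (q.eval (X k')))) ?_ (by omega)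
      · have h2 : ∑ l ∈ upper Z k, (f * q).eval (X l) =
            q.eval (X k') * gen K m Z M k' +
            ∑ l ∈ upper Z (k + 1),
              (f * (q - Polynomial.C (q.eval (X k')))).eval (X l) := by
          simp only [gen_of_notMem hZ, show ¬ (k' : ℕ) < M from not_lt.2 hk, if_false, one_mul,
            Finset.mul_sum]
          have h3 := sum_upper_eq_add hZ
            fun l => (f * (q - Polynomial.C (q.eval (X k')))).eval (X l)
          simp only [Polynomial.eval_mul, Polynomial.eval_sub, Polynomial.eval_C, sub_self,
            mul_zero, zero_add] at h3 ⊢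
          rw [← h3, ← Finset.sum_add_distrib]
          refine Finset.sum_congr rfl fun l _ => ?_
          rw [hf, Polynomial.eval_prod]
          simp
          ring
        rw [h2]
        exact add_mem (Ideal.mul_mem_left _ _ (Ideal.subset_span ⟨k', le_refl k, rfl⟩)) (hle h1)
      · refine (Finset.prod_dvd_prod_of_subset _ _ _
          (lowerNbrs_succ_subset_insert m Z k')).trans ?_
        rw [Finset.prod_insert (by simp [mem_lowerNbrs]), mul_comm]
        exact mul_dvd_mul_left _ (Polynomial.dvd_iff_isRoot.2 (by simp))

/-- The difference of the two main terms is the sum of F(x_l) over l ≥ j, for F = (t - x_j) ∏ (t -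
x_i). The term l = j vanishes, and `sum_eval_mem_span` puts the rest in the ideal of the later
generators, whence v j = 0. -/
theorem exists_gen_succ_eq {j : Fin n} (hj : j ∉ Z) :
    ∃ v : Fin n → MvPolynomial (Fin n) K, v j = 0 ∧
      gen K m Z (j + 1) j = X j * gen K m Z j j + v ⬝ᵥ gen K m Z (j + 1) := by
  have h1 := sum_eval_mem_span (K := K) (m := m) (Z := Z) ((j : ℕ) + 1) le_rfl
    ((Polynomial.X - Polynomial.C (X j)) *
      ∏ i ∈ lowerNbrs m Z j, (Polynomial.X - Polynomial.C (X i))) (by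
      rw [← Finset.prod_insert (f := fun i : Fin n => Polynomial.X - Polynomial.C
        (X i : MvPolynomial (Fin n) K)) (s := lowerNbrs m Z j) (by simp [mem_lowerNbrs])]
      exact Finset.prod_dvd_prod_of_subset _ _ _ (lowerNbrs_succ_subset_insert m Z j))
  have h2 := sum_upper_eq_add (R := MvPolynomial (Fin n) K) hj fun l =>
    Polynomial.eval (X l) ((Polynomial.X - Polynomial.C (X j)) *
      ∏ i ∈ lowerNbrs m Z j, (Polynomial.X - Polynomial.C (X i)))
  rw [show ({l : Fin n | (j : ℕ) + 1 ≤ l} : Set (Fin n)) =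
    (({l : Fin n | (j : ℕ) + 1 ≤ l} : Finset (Fin n)) : Set (Fin n)) by simp, Ideal.span,
    Submodule.mem_span_image_finset_iff_exists_fun'] at h1
  obtain ⟨c, hc⟩ := h1
  refine ⟨fun l => if (j : ℕ) + 1 ≤ l then c l else 0, by simp, ?_⟩
  have h3 : (fun l : Fin n => if (j : ℕ) + 1 ≤ l then c l else 0) ⬝ᵥ gen K m Z (j + 1) =
      ∑ l ∈ ({l : Fin n | (j : ℕ) + 1 ≤ l} : Finset (Fin n)), c l • gen K m Z (j + 1) l := by
    rw [Finset.sum_filter]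
    exact Finset.sum_congr rfl fun l _ => by simp
  simp only [Polynomial.eval_mul, Polynomial.eval_sub, Polynomial.eval_C, Polynomial.eval_X,
    sub_self, zero_mul, zero_add, Polynomial.eval_prod] at h2 hc
  rw [h3, hc, ← h2]
  simp only [gen_of_notMem hj, lt_irrefl, Nat.lt_succ_self, if_true, if_false, Finset.mul_sum,
    ← Finset.sum_add_distrib]
  exact Finset.sum_congr rfl fun l _ => by ring

end Generators

/-! ### Deletion and contraction. -/

section Induction

variable {K : Type*} [Field K] {n : ℕ} {m : Fin n → ℕ} {Z : Finset (Fin n)} {M : ℕ}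

theorem gen_congr {M' : ℕ} {k : Fin n} (h : k ∉ Z → ((k : ℕ) < M ↔ (k : ℕ) < M')) :
    gen K m Z M k = gen K m Z M' k := by
  by_cases hk : k ∈ Z
  · rw [gen, gen, if_pos hk, if_pos hk]
  · simp only [gen_of_notMem hk, h hk]

theorem height_congr {M' : ℕ} {k : Fin n} (h : k ∉ Z → ((k : ℕ) < M ↔ (k : ℕ) < M')) :
    height m Z M k = height m Z M' k := by
  by_cases hk : k ∈ Z
  · rw [height, height, if_pos hk, if_pos hk]
  · simp only [height, hk, if_false, h hk]

theorem lowerNbrs_insert (j : Fin n) (k : ℕ) :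
    lowerNbrs m (insert j Z) k = (lowerNbrs m Z k).erase j := by
  ext i
  simp only [Finset.mem_erase, mem_lowerNbrs, Finset.mem_insert]
  tauto

theorem upper_insert (j : Fin n) (k : ℕ) : upper (insert j Z) k = (upper Z k).erase j := by
  ext i
  simp only [Finset.mem_erase, mem_upper, Finset.mem_insert]
  tauto

/-- After merging j, the origin is adjacent to the vertices below j and to the old upper neighbours
of j, so row 0 ends at max (m j) j. For k < j the lost summand l = j carries the origin factor x_j;
for k > j a factor x_l - x_j becomes the origin factor x_l. -/
theorem X_dvd_gen_sub_gen {j k : Fin n} (hj : j ∉ Z) (hkj : k ≠ j) :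
    X j ∣ gen K m Z (j + 1) k - gen K m (insert j Z) (max (m j) j) k := by
  by_cases hk : k ∈ Z
  · simp [gen, hk]
  have hk' : k ∉ insert j Z := by simp [hk, hkj]
  rw [gen_of_notMem hk, gen_of_notMem hk']
  rcases lt_or_gt_of_ne hkj with hlt | hlt
  · have hlt' : (k : ℕ) < j := hlt
    have h1 : j ∉ lowerNbrs m Z k := fun h => absurd (mem_lowerNbrs.1 h).1 (by omega)
    have h2 : j ∈ upper Z k := mem_upper.2 ⟨hlt'.le, hj⟩
    rw [lowerNbrs_insert, upper_insert, Finset.erase_eq_of_notMem h1,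
      ← Finset.add_sum_erase _ _ h2]
    simp only [show (k : ℕ) < j + 1 by omega, show (k : ℕ) < max (m j) j by omega, if_true,
      add_sub_cancel_right]
    exact dvd_mul_right _ _
  · have hlt' : (j : ℕ) < k := hlt
    have h2 : j ∉ upper Z k := fun h => absurd (mem_upper.1 h).1 (by omega)
    rw [upper_insert, Finset.erase_eq_of_notMem h2, lowerNbrs_insert, ← Finset.sum_sub_distrib]
    refine Finset.dvd_sum fun l _ => ?_
    rw [if_neg (show ¬ (k : ℕ) < j + 1 by omega), one_mul]
    by_cases hkm : (k : ℕ) < m j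
    · have h1 : j ∈ lowerNbrs m Z k := mem_lowerNbrs.2 ⟨hlt', hj, hkm⟩
      rw [if_pos (lt_max_of_lt_left hkm), ← Finset.mul_prod_erase _ _ h1, ← sub_mul]
      exact Dvd.dvd.mul_right (by simp) _
    · have h1 : j ∉ lowerNbrs m Z k := fun h => hkm (mem_lowerNbrs.1 h).2.2
      rw [if_neg (show ¬ (k : ℕ) < max (m j) j by omega), Finset.erase_eq_of_notMem h1, one_mul,
        sub_self]
      exact dvd_zero _

theorem height_deletion {j : Fin n} (hj : j ∉ Z) :
    height m Z j = Function.update (height m Z (j + 1)) j (height m Z (j + 1) j - 1) := by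
  ext k
  rcases eq_or_ne k j with rfl | hk
  · simp [height, hj]
  · rw [Function.update_of_ne hk]
    have : (k : ℕ) ≠ j := fun h => hk (Fin.ext h)
    exact height_congr fun _ => by omega

/-- A vertex k > j was not adjacent to the origin, so when it loses the neighbour j it gains the
origin instead and the count is unchanged. -/
theorem height_contraction {j : Fin n} (hj : j ∉ Z) :
    height m (insert j Z) (max (m j) j) = Function.update (height m Z (j + 1)) j 1 := by
  ext k
  rcases eq_or_ne k j with rfl | hkj
  · simp [height]
  rw [Function.update_of_ne hkj, height, height]
  by_cases hk : k ∈ Z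
  · simp [hk]
  rw [if_neg hk, if_neg (by simp [hk, hkj]), lowerNbrs_insert]
  have hne : (k : ℕ) ≠ j := fun h => hkj (Fin.ext h)
  by_cases hjk : j ∈ lowerNbrs m Z k
  · have h := mem_lowerNbrs.1 hjk
    have := Finset.card_pos.2 ⟨j, hjk⟩
    rw [Finset.card_erase_of_mem hjk, if_pos (by omega), if_neg (by omega)]
    omega
  · rw [Finset.erase_eq_of_notMem hjk]
    rw [mem_lowerNbrs] at hjk
    congr 2
    simp only [eq_iff_iff]
    have : ¬ ((j : ℕ) < k ∧ (k : ℕ) < m j) := fun h => hjk ⟨h.1, hj, h.2⟩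
    omega

variable (K m Z M) in
/-- The syzygies of the generators are Koszul, and the monomials below the heights descend to a
basis of the quotient by the generators. -/
def IsGood : Prop :=
  OnlyKoszulSyzygies (gen K m Z M) ∧
    IsBoxBasis (height m Z M) (Ideal.span (Set.range (gen K m Z M)))

theorem IsGood.of_deletion_of_contraction {j : Fin n} (hj : j ∉ Z) (h' : IsGood K m Z j)
    (h'' : IsGood K m (insert j Z) (max (m j) j)) : IsGood K m Z (j + 1) := by
  set g := gen K m Z (j + 1) with hg
  set y := gen K m Z j j
  have hg' : gen K m Z j = Function.update g j y := by
    ext1 k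
    rcases eq_or_ne k j with rfl | hk
    · simp [y]
    · rw [Function.update_of_ne hk]
      have : (k : ℕ) ≠ j := fun h => hk (Fin.ext h)
      exact gen_congr fun _ => by omega
  obtain ⟨v, hvj, hv⟩ := exists_gen_succ_eq (K := K) (m := m) hj
  rw [← hg] at hv
  have hsum : v ⬝ᵥ Function.update g j (X j * y) = v ⬝ᵥ g := by
    refine Finset.sum_congr rfl fun k _ => ?_
    rcases eq_or_ne k j with rfl | hk
    · simp [hvj]
    · rw [Function.update_of_ne hk]
  -- A transvection, as v does not involve the index j.
  have hgv : g = Function.update g j (X j * y) +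
      (v ⬝ᵥ Function.update g j (X j * y)) • Pi.single j 1 := by
    ext1 k
    rw [hsum]
    rcases eq_or_ne k j with rfl | hk
    · simpa using hv
    · simp [hk]
  have hvs : v ⬝ᵥ Pi.single j 1 = 0 := by simp [hvj]
  choose! u hu using fun k (hk : k ≠ j) => X_dvd_gen_sub_gen (K := K) (m := m) hj hk
  set g'' := gen K m (insert j Z) (max (m j) j)
  have hj'' : g'' j = X j := by simp [g'', gen]
  -- Likewise a transvection: multiples of the j-th entry x_j of `g''` are added to the other
  -- entries.
  have hgu : Function.update g j (X j) =
      g'' + (Pi.single j 1 ⬝ᵥ g'') • Function.update u j 0 := by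
    ext1 k
    rcases eq_or_ne k j with rfl | hk
    · simp [hj'']
    · simp [hk, hj'', ← hu k hk, hg]
  have hus : Pi.single j 1 ⬝ᵥ Function.update u j 0 = 0 := by simp
  have hx : OnlyKoszulSyzygies (Function.update g j (X j)) := hgu ▸ h''.1.add_smul hus
  have hspan : Ideal.span (Set.range g) = Ideal.span (Set.range (Function.update g j (X j * y))) := by
    conv_lhs => rw [hgv]
    exact span_range_add_smul hvs _
  refine ⟨?_, ?_⟩
  · rw [← hg, hgv]
    exact (hx.update_mul (hg' ▸ h'.1)).add_smul hvs
  · refine IsBoxBasis.of_exact (j := j) (by simp [height, hj]) (height_deletion hj ▸ h'.2)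
      (height_contraction hj ▸ h''.2) (fun p => ?_) ?_
    · rw [hg', hspan]
      exact ⟨hx.mem_of_mul_mem, mul_mem_span_range_update⟩
    · rw [hspan, ← span_range_update_eq_sup, hgu, span_range_add_smul hus]

/-- Adjacency to the origin is ignored at merged vertices; the case M ≥ n is included vacuously. -/
theorem IsGood.of_forall_mem (h : IsGood K m Z M) (hM : ∀ j : Fin n, (j : ℕ) = M → j ∈ Z) :
    IsGood K m Z (M + 1) := by
  have key (k : Fin n) (hk : k ∉ Z) : (k : ℕ) < M + 1 ↔ (k : ℕ) < M := by
    have : (k : ℕ) ≠ M := fun h => hk (hM k h)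
    omega
  rw [IsGood, show gen K m Z (M + 1) = gen K m Z M from _root_.funext fun k => gen_congr (key k),
    show height m Z (M + 1) = height m Z M from _root_.funext fun k => height_congr (key k)]
  exact h

theorem isGood_zero [CharZero K] : IsGood K m Z 0 := by
  by_cases hZ : Z = Finset.univ
  · have h1 : gen K m Z 0 = X := by ext1 k; simp [gen, hZ]
    have h2 : height m Z 0 = fun _ => 1 := by ext1 k; simp [height, hZ]
    rw [IsGood, h1, h2]
    exact ⟨onlyKoszulSyzygies_X K n, isBoxBasis_span_X⟩
  · have hne : Zᶜ.Nonempty := by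
      rwa [Finset.nonempty_iff_ne_empty, Ne, Finset.compl_eq_empty_iff]
    obtain ⟨k, hk, hmin⟩ := Zᶜ.exists_minimal hne
    rw [Finset.mem_compl] at hk
    have hlow : lowerNbrs m Z k = ∅ := by
      refine Finset.eq_empty_of_forall_notMem fun i hi => ?_
      obtain ⟨h1, h2, -⟩ := mem_lowerNbrs.1 hi
      exact absurd (hmin (Finset.mem_compl.2 h2) (le_of_lt h1)) (not_le.2 h1)
    have hunit : IsUnit (gen K m Z 0 k) := by
      rw [gen_of_notMem hk]
      simp only [not_lt_zero, if_false, hlow, Finset.prod_empty, Finset.sum_const,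
        nsmul_eq_mul, mul_one]
      rw [← map_natCast (C : K →+* MvPolynomial (Fin n) K)]
      refine (IsUnit.mk0 _ ?_).map C
      exact Nat.cast_ne_zero.2 (Finset.card_ne_zero_of_mem
        (show k ∈ upper Z k from mem_upper.2 ⟨le_rfl, hk⟩))
    refine ⟨.of_isUnit hunit, ?_⟩
    rw [Ideal.eq_top_of_isUnit_mem _ (Ideal.subset_span (Set.mem_range_self k)) hunit]
    exact isBoxBasis_top (j := k) (by simp [height, hk, hlow])

theorem isGood [CharZero K] (m : Fin n → ℕ) (Z : Finset (Fin n)) (M : ℕ) : IsGood K m Z M := by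
  -- The outer induction must allow every M, because contraction can increase it.
  induction hd : Zᶜ.card using Nat.strong_induction_on generalizing Z M with
  | _ d ihZ =>
    induction M with
    | zero => exact isGood_zero
    | succ M ihM =>
      by_cases hM : ∀ j : Fin n, (j : ℕ) = M → j ∈ Z
      · exact ihM.of_forall_mem hM
      · push Not at hM
        obtain ⟨j, rfl, hj⟩ := hM
        refine ihM.of_deletion_of_contraction hj (ihZ _ ?_ _ _ rfl)
        rw [← hd]
        exact Finset.card_lt_card
          (Finset.compl_ssubset_compl.2 (Finset.ssubset_insert hj))

end Induction

/-! ### Linear forms and their kernels. -/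

section LinearPoly

variable {K : Type*} [Field K] {n : ℕ}

theorem linearPoly_smul (c : K) (α : Module.Dual K (Fin n → K)) :
    linearPoly (c • α) = C c * linearPoly α := by
  simp [linearPoly, Finset.mul_sum, mul_assoc]

theorem linearPoly_sub (α β : Module.Dual K (Fin n → K)) :
    linearPoly (α - β) = linearPoly α - linearPoly β := by
  simp [linearPoly, sub_mul]

theorem linearPoly_extCoord_zero : linearPoly (extCoord K (0 : Fin (n + 1))) = 0 := by
  simp [linearPoly, extCoord]

theorem linearPoly_extCoord_succ (i : Fin n) : linearPoly (extCoord K i.succ) = X i := by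
  simp [linearPoly, extCoord, Pi.single_apply]

theorem eval_linearPoly (α : Module.Dual K (Fin n → K)) (v : Fin n → K) :
    eval v (linearPoly α) = α v := by
  conv_rhs => rw [← Finset.univ_sum_single v, map_sum]
  rw [linearPoly, map_sum]
  refine Finset.sum_congr rfl fun i _ => ?_
  have : (Pi.single i (v i) : Fin n → K) = v i • Pi.single i 1 := by
    rw [← Pi.single_smul, smul_eq_mul, mul_one]
  rw [this, map_smul, map_mul, eval_C, eval_X, smul_eq_mul, mul_comm]

theorem ker_le_ker_of_linearPoly_dvd {α β : Module.Dual K (Fin n → K)}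
    (h : linearPoly α ∣ linearPoly β) : LinearMap.ker α ≤ LinearMap.ker β := by
  intro v hv
  rw [LinearMap.mem_ker, ← eval_linearPoly] at *
  obtain ⟨r, hr⟩ := h
  rw [hr, map_mul, hv, zero_mul]

theorem exists_eq_smul_of_ker_le_ker {α β : Module.Dual K (Fin n → K)}
    (h : LinearMap.ker α ≤ LinearMap.ker β) : ∃ c : K, β = c • α := by
  have := mem_span_of_iInf_ker_le_ker (L := fun _ : Unit => α) (K := β) (by simpa using h)
  rw [Set.range_const, Submodule.mem_span_singleton] at this
  obtain ⟨c, hc⟩ := this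
  exact ⟨c, hc.symm⟩

theorem irreducible_linearPoly {α : Module.Dual K (Fin n → K)} (h : α ≠ 0) :
    Irreducible (linearPoly α) := by
  set c : Fin n →₀ K := Finsupp.equivFunOnFinite.symm fun i => α (Pi.single i 1) with hc
  have h1 : linearPoly α = sumSMulX c := by
    rw [sumSMulX, Finsupp.linearCombination_apply, Finsupp.sum_fintype _ _ (by simp)]
    simp [linearPoly, hc, smul_eq_C_mul]
  have h2 : ∃ i, c i ≠ 0 := by
    by_contra! h3
    exact h (LinearMap.pi_ext' fun i => LinearMap.ext_ring (h3 i))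
  obtain ⟨i, hi⟩ := h2
  rw [h1]
  exact irreducible_sumSMulX c ⟨i, Finsupp.mem_support_iff.2 hi⟩
    fun r hr => isUnit_of_dvd_unit (hr i) (IsUnit.mk0 _ hi)

theorem ne_zero_of_finrank_quotient_ker {α : Module.Dual K (Fin n → K)}
    (h : Module.finrank K ((Fin n → K) ⧸ LinearMap.ker α) = 1) : α ≠ 0 := by
  rintro rfl
  rw [LinearMap.ker_zero] at h
  have : Subsingleton ((Fin n → K) ⧸ (⊤ : Submodule K (Fin n → K))) :=
    Submodule.Quotient.subsingleton_iff.2 rfl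
  rw [Module.finrank_zero_of_subsingleton] at h
  exact zero_ne_one h

theorem ker_eq_ker_of_ker_le_ker {α β : Module.Dual K (Fin n → K)} (hβ : β ≠ 0)
    (h : LinearMap.ker α ≤ LinearMap.ker β) : LinearMap.ker α = LinearMap.ker β := by
  obtain ⟨c, rfl⟩ := exists_eq_smul_of_ker_le_ker h
  have hc : c ≠ 0 := by rintro rfl; simp at hβ
  exact (LinearMap.ker_smul α c hc).symm

end LinearPoly

/-! ### Logarithmic derivations tested on one hyperplane at a time. -/

section DerModule

variable {K : Type*} [Field K] {n : ℕ} {A : Finset (Submodule K (Fin n → K))}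
  {θ : Derivation K (MvPolynomial (Fin n) K) (MvPolynomial (Fin n) K)}

/-- Choose a defining polynomial with α as a factor. By the Leibniz rule α divides θ(α) times the
other factors; α is prime and divides none of those, their kernels being different. -/
theorem linearPoly_dvd_apply_of_mem_derModule (hA : IsArrangement A) (hθ : θ ∈ derModule A)
    {α : Module.Dual K (Fin n → K)} (hα : LinearMap.ker α ∈ A) :
    linearPoly α ∣ θ (linearPoly α) := by
  classical
  obtain ⟨-, γ, hγ, -⟩ := hA.exists_isDefiningPolynomial
  set H := LinearMap.ker α with hH
  let δ := Function.update γ H α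
  have hδ : ∀ H' ∈ A, LinearMap.ker (δ H') = H' := by
    intro H' hH'
    rcases eq_or_ne H' H with rfl | h
    · simp [δ, hH]
    · simpa [δ, h] using hγ H' hH'
  have hδ0 : ∀ H' ∈ A, δ H' ≠ 0 := fun H' hH' =>
    ne_zero_of_finrank_quotient_ker (by rw [hδ H' hH']; exact hA H' hH')
  have hδH : δ H = α := by simp [δ]
  have hQ : linearPoly α * ∏ H' ∈ A.erase H, linearPoly (δ H') ∣
      θ (linearPoly α * ∏ H' ∈ A.erase H, linearPoly (δ H')) := by
    have := hθ _ ⟨δ, hδ, rfl⟩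
    rwa [← Finset.mul_prod_erase A _ hα, hδH] at this
  have hirr := irreducible_linearPoly (hδH ▸ hδ0 H hα)
  have hdvd := (dvd_mul_right _ _).trans hQ
  rw [Derivation.leibniz, smul_eq_mul, smul_eq_mul,
    dvd_add_right (dvd_mul_right _ _)] at hdvd
  refine (hirr.prime.dvd_or_dvd hdvd).resolve_left fun h => ?_
  obtain ⟨H', hH', h⟩ := (hirr.prime.dvd_finsetProd_iff _).1 h
  have hH'A := Finset.mem_of_mem_erase hH'
  have := ker_eq_ker_of_ker_le_ker (hδ0 _ hH'A) (ker_le_ker_of_linearPoly_dvd h)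
  rw [hδ _ hH'A] at this
  exact Finset.ne_of_mem_erase hH' this.symm

theorem mem_derModule_of_forall_linearPoly_dvd
    (h : ∀ H ∈ A, ∃ α : Module.Dual K (Fin n → K), LinearMap.ker α = H ∧
      linearPoly α ∣ θ (linearPoly α)) : θ ∈ derModule A := by
  rintro _ ⟨δ, hδ, rfl⟩
  have key : ∀ H ∈ A, linearPoly (δ H) ∣ θ (linearPoly (δ H)) := by
    intro H hH
    obtain ⟨α, hα, hdvd⟩ := h H hH
    obtain ⟨c, hc⟩ := exists_eq_smul_of_ker_le_ker (hα.trans (hδ H hH).symm).le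
    rw [hc, linearPoly_smul, ← smul_eq_C_mul, θ.map_smul, smul_eq_C_mul, smul_eq_C_mul]
    exact mul_dvd_mul_left _ hdvd
  clear h hδ
  classical
  induction A using Finset.induction_on with
  | empty => simp
  | insert H s hH ih =>
    rw [Finset.prod_insert hH, Derivation.leibniz, smul_eq_mul, smul_eq_mul]
    refine dvd_add (mul_dvd_mul_left _ (ih fun H' hH' => key H' (Finset.mem_insert_of_mem hH'))) ?_
    exact (mul_comm _ _).dvd.trans (mul_dvd_mul_left _ (key H (Finset.mem_insert_self _ _)))

end DerModule

/-! ### The derivation module of a southwest arrangement. -/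

section Southwest

variable {K : Type*} [Field K] {n : ℕ} {A : Finset (Submodule K (Fin n → K))}

/-- Viewing Kⁿ as Kⁿ⁺¹ modulo the diagonal treats x₀ like the other coordinates. -/
theorem extCoord_apply_sub (s : Fin (n + 1) → K) (k : Fin (n + 1)) :
    extCoord K k (fun l => s l.succ - s 0) = s k - s 0 := by
  induction k using Fin.cases <;> simp [extCoord]

theorem eq_of_hyp_le_hyp {i i' j : Fin (n + 1)} (hj : i' ≠ j) (h : hyp K i j ≤ hyp K i' j) :
    i = i' := by
  by_contra hne
  have := @h (fun l => (Pi.single i' 1 : Fin (n + 1) → K) l.succ -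
    (Pi.single i' 1 : Fin (n + 1) → K) 0) (by
      rw [hyp, LinearMap.mem_ker, LinearMap.sub_apply, extCoord_apply_sub, extCoord_apply_sub]
      simp [hne, hj.symm])
  rw [hyp, LinearMap.mem_ker, LinearMap.sub_apply, extCoord_apply_sub, extCoord_apply_sub] at this
  simp [hj.symm] at this

theorem linearPoly_extCoord_zero_sub (k : Fin n) :
    linearPoly (extCoord K 0 - extCoord K k.succ) = - X k := by
  rw [linearPoly_sub, linearPoly_extCoord_zero, linearPoly_extCoord_succ, zero_sub]

theorem linearPoly_extCoord_succ_sub (i k : Fin n) :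
    linearPoly (extCoord K i.succ - extCoord K k.succ) = X i - X k := by
  rw [linearPoly_sub, linearPoly_extCoord_succ, linearPoly_extCoord_succ]

theorem isRelPrime_linearPoly {i i' j : Fin (n + 1)} (hi : i ≠ j) (hi' : i' ≠ j) (h : i ≠ i') :
    IsRelPrime (linearPoly (extCoord K i - extCoord K j))
      (linearPoly (extCoord K i' - extCoord K j)) := by
  rw [(irreducible_linearPoly (sub_ne_zero.2 fun e => hi
    (extCoord_injective e))).isRelPrime_iff_not_dvd]
  exact fun hd => h (eq_of_hyp_le_hyp hi' (ker_le_ker_of_linearPoly_dvd hd))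

theorem isRelPrime_X_sub_X {i k : Fin n} (h : i ≠ k) :
    IsRelPrime (X k : MvPolynomial (Fin n) K) (X k - X i) := by
  have := isRelPrime_linearPoly (K := K) (Fin.succ_ne_zero k).symm
    ((Fin.succ_injective n).ne h) (Fin.succ_ne_zero i).symm
  rwa [linearPoly_extCoord_zero_sub, linearPoly_extCoord_succ_sub, ← neg_sub (X k) (X i),
    IsRelPrime.neg_neg_iff] at this

theorem isRelPrime_X_sub_X_sub {i i' k : Fin n} (h : i ≠ k) (h' : i' ≠ k) (hi : i ≠ i') :
    IsRelPrime (X k - X i : MvPolynomial (Fin n) K) (X k - X i') := by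
  have := isRelPrime_linearPoly (K := K) ((Fin.succ_injective n).ne h)
    ((Fin.succ_injective n).ne h') ((Fin.succ_injective n).ne hi)
  rwa [linearPoly_extCoord_succ_sub, linearPoly_extCoord_succ_sub, ← neg_sub (X k) (X i),
    ← neg_sub (X k) (X i'), IsRelPrime.neg_neg_iff] at this

/-- The hyperplanes of a southwest arrangement in the row of `i` form an interval. -/
theorem IsSouthwest.exists_reach (hA : IsSouthwest A) :
    ∃ r : Fin (n + 1) → ℕ, ∀ i j, i < j → (hyp K i j ∈ A ↔ (j : ℕ) ≤ r i) := by
  classical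
  refine ⟨fun i => ({j | hyp K i j ∈ A} : Finset (Fin (n + 1))).sup (fun j => (j : ℕ)),
    fun i j hij => ⟨fun h => Finset.le_sup (f := fun j : Fin (n + 1) => (j : ℕ)) (by simpa using h),
      fun h => ?_⟩⟩
  -- An empty row has supremum 0, which is harmless since j > 0.
  rw [Finset.le_sup_iff (show (⊥ : ℕ) < j from lt_of_le_of_lt (Nat.zero_le _) hij)] at h
  obtain ⟨k, hk, hjk⟩ := h
  replace hk : hyp K i k ∈ A := by simpa using hk
  have key : ∀ d, ∀ k : Fin (n + 1), (k : ℕ) = j + d → hyp K i k ∈ A → hyp K i j ∈ A := by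
    intro d
    induction d with
    | zero => exact fun k hk h => (Fin.ext hk : k = j) ▸ h
    | succ d ih =>
      intro k hk h
      have hlt := k.2
      have hij' : (i : ℕ) < j := hij
      exact ih ⟨j + d, by omega⟩ rfl
        (hA.closed i ⟨j + d, by omega⟩ k (Fin.lt_def.2 (by simp; omega)) (by simp [hk]; omega) h)
  exact key (k - j) k (by omega) hk

/-- The arrangement `A` is described by `m` and `M`: it contains `H_{0,k}` for `k < M` and
`H_{i,k}` for `i < k < m i` (in terms of the indices of the coordinates). -/
structure IsDescribedBy (A : Finset (Submodule K (Fin n → K))) (m : Fin n → ℕ) (M : ℕ) : Prop where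
  isArrangement : IsArrangement A
  subset : (A : Set (Submodule K (Fin n → K))) ⊆ augmentedBraid K n
  zero_mem_iff : ∀ k : Fin n, hyp K 0 k.succ ∈ A ↔ (k : ℕ) < M
  succ_mem_iff : ∀ i k : Fin n, i < k → (hyp K i.succ k.succ ∈ A ↔ (k : ℕ) < m i)

theorem IsSouthwest.exists_isDescribedBy (hA : IsSouthwest A) : ∃ m M, IsDescribedBy A m M := by
  obtain ⟨r, hr⟩ := hA.exists_reach
  -- The index shift makes k + 1 ≤ r the same as k < r.
  exact ⟨fun i => r i.succ, r 0, hA.isArrangement, hA.subset, fun k => hr 0 _ (Fin.succ_pos k),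
    fun i k hik => hr _ _ (Fin.succ_lt_succ_iff.2 hik)⟩

variable {m : Fin n → ℕ} {M : ℕ}

theorem IsDescribedBy.hSeq_eq (hA : IsDescribedBy A m M) : hSeq A = height m ∅ M := by
  classical
  ext k
  have h1 : (A : Set (Submodule K (Fin n → K))) ∩
      {H | ∃ i : Fin (n + 1), i < k.succ ∧ H = hyp K i k.succ} =
      (fun i => hyp K i k.succ) ''
        (({i | i < k.succ ∧ hyp K i k.succ ∈ A} : Finset (Fin (n + 1))) : Set (Fin (n + 1))) := by
    ext H
    simp only [Set.mem_inter_iff, Finset.mem_coe, Set.mem_ofPred_eq, Set.mem_image,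
      Finset.mem_filter, Finset.mem_univ, true_and]
    constructor
    · rintro ⟨h, i, hi, rfl⟩
      exact ⟨i, ⟨hi, h⟩, rfl⟩
    · rintro ⟨i, ⟨hi, h⟩, rfl⟩
      exact ⟨h, i, hi, rfl⟩
  rw [hSeq, h1, Set.InjOn.ncard_image, Set.ncard_coe_finset, Finset.card_filter,
    Fin.sum_univ_succ, ← Finset.card_filter]
  · simp only [Fin.succ_pos, hA.zero_mem_iff, true_and, height, Finset.notMem_empty, if_false]
    congr 2
    ext i
    simp only [Finset.mem_filter, Finset.mem_univ, true_and, mem_lowerNbrs, Finset.notMem_empty,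
      not_false_eq_true, Fin.succ_lt_succ_iff]
    exact and_congr_right fun h => hA.succ_mem_iff i k h
  · intro i _ i' hi' h
    simp only [Finset.coe_filter, Finset.mem_univ, true_and, Set.mem_ofPred_eq] at hi'
    exact eq_of_hyp_le_hyp hi'.1.ne h.le

theorem IsDescribedBy.mem_derModule_iff (hA : IsDescribedBy A m M)
    {θ : Derivation K (MvPolynomial (Fin n) K) (MvPolynomial (Fin n) K)} :
    θ ∈ derModule A ↔ (∀ k : Fin n, (k : ℕ) < M → X k ∣ θ (X k)) ∧
      ∀ i k : Fin n, i < k → (k : ℕ) < m i → X k - X i ∣ θ (X k) - θ (X i) := by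
  constructor
  · intro hθ
    refine ⟨fun k hk => ?_, fun i k hik hk => ?_⟩
    · have := linearPoly_dvd_apply_of_mem_derModule hA.isArrangement hθ
        ((hA.zero_mem_iff k).2 hk)
      rwa [linearPoly_extCoord_zero_sub, map_neg, neg_dvd, dvd_neg] at this
    · have := linearPoly_dvd_apply_of_mem_derModule hA.isArrangement hθ
        ((hA.succ_mem_iff i k hik).2 hk)
      rwa [linearPoly_extCoord_succ_sub, map_sub, ← neg_sub (X k), ← neg_sub (θ (X k)), neg_dvd,
        dvd_neg] at this
  · rintro ⟨h0, h1⟩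
    refine mem_derModule_of_forall_linearPoly_dvd fun H hH => ?_
    obtain ⟨i, j, hij, rfl⟩ := hA.subset hH
    refine ⟨_, rfl, ?_⟩
    obtain ⟨k, rfl⟩ := Fin.exists_succ_eq.2 (Fin.ne_zero_of_lt hij)
    induction i using Fin.cases with
    | zero =>
      rw [linearPoly_extCoord_zero_sub, map_neg, neg_dvd, dvd_neg]
      exact h0 k ((hA.zero_mem_iff k).1 hH)
    | succ i =>
      rw [Fin.succ_lt_succ_iff] at hij
      rw [linearPoly_extCoord_succ_sub, map_sub, ← neg_sub (X k), ← neg_sub (θ (X k)), neg_dvd,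
        dvd_neg]
      exact h1 i k hij ((hA.succ_mem_iff i k hij).1 hH)

variable (K m M) in
/-- The polynomial `∏ (t - x_i)` over the lower neighbours of `k`, including the origin. -/
noncomputable def nbrPoly (k : ℕ) : Polynomial (MvPolynomial (Fin n) K) :=
  (if k < M then Polynomial.X else 1) *
    ∏ i ∈ lowerNbrs m ∅ k, (Polynomial.X - Polynomial.C (X i))

theorem eval_nbrPoly (k : ℕ) (t : MvPolynomial (Fin n) K) :
    (nbrPoly K m M k).eval t =
      (if k < M then t else 1) * ∏ i ∈ lowerNbrs m ∅ k, (t - X i) := by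
  rw [nbrPoly, Polynomial.eval_mul, Polynomial.eval_prod]
  split_ifs <;> simp

variable (K m M) in
/-- The members `θ_k` of a basis of the derivation module. -/
noncomputable def basisDer (k : Fin n) :
    Derivation K (MvPolynomial (Fin n) K) (MvPolynomial (Fin n) K) :=
  mkDerivation K fun l => if k ≤ l then (nbrPoly K m M k).eval (X l) else 0

theorem basisDer_X (k l : Fin n) :
    basisDer K m M k (X l) = if k ≤ l then (nbrPoly K m M k).eval (X l) else 0 :=
  mkDerivation_X _ _ _

theorem sum_basisDer_X (k : Fin n) : ∑ l, basisDer K m M k (X l) = gen K m ∅ M k := by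
  simp only [basisDer_X]
  rw [← Finset.sum_filter, gen_of_notMem (Finset.notMem_empty k)]
  refine Finset.sum_congr (by ext; simp [mem_upper]) fun l _ => eval_nbrPoly _ _

theorem IsDescribedBy.basisDer_mem (hA : IsDescribedBy A m M) (j : Fin n) :
    basisDer K m M j ∈ derModule A := by
  rw [hA.mem_derModule_iff]
  refine ⟨fun k hk => ?_, fun i k hik hk => ?_⟩
  · rw [basisDer_X]
    split_ifs with hjk
    · rw [eval_nbrPoly, if_pos (lt_of_le_of_lt (Fin.le_def.1 hjk) hk)]
      exact dvd_mul_right _ _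
    · exact dvd_zero _
  · rw [basisDer_X, basisDer_X]
    by_cases hji : j ≤ i
    · rw [if_pos hji, if_pos (hji.trans hik.le)]
      exact Polynomial.sub_dvd_eval_sub _ _ _
    · rw [if_neg hji, sub_zero]
      split_ifs with hjk
      · rw [eval_nbrPoly]
        -- As i < j ≤ k < m i and row i is an interval, i is a lower neighbour of j.
        refine Dvd.dvd.mul_left (Finset.dvd_prod_of_mem (fun i => X k - X i) ?_) _
        rw [mem_lowerNbrs]
        exact ⟨not_le.1 hji, Finset.notMem_empty _, lt_of_le_of_lt hjk hk⟩
      · exact dvd_zero _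

/-- Each neighbour of k gives a linear divisor of θ(x_k), and these are pairwise coprime. -/
theorem IsDescribedBy.eval_nbrPoly_dvd (hA : IsDescribedBy A m M)
    {θ : Derivation K (MvPolynomial (Fin n) K) (MvPolynomial (Fin n) K)} (hθ : θ ∈ derModule A)
    {k : Fin n} (h : ∀ l < k, θ (X l) = 0) : (nbrPoly K m M k).eval (X k) ∣ θ (X k) := by
  obtain ⟨h0, h1⟩ := hA.mem_derModule_iff.1 hθ
  have hne : ∀ i ∈ lowerNbrs m ∅ k, i ≠ k := fun i hi => ne_of_lt (mem_lowerNbrs.1 hi).1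
  have hprod : ∏ i ∈ lowerNbrs m ∅ k, (X k - X i) ∣ θ (X k) := by
    refine Finset.prod_dvd_of_isRelPrime (fun i hi i' hi' hii' => ?_) fun i hi => ?_
    · exact isRelPrime_X_sub_X_sub (hne i hi) (hne i' hi') hii'
    · obtain ⟨hik, -, hkm⟩ := mem_lowerNbrs.1 hi
      simpa [h i hik] using h1 i k hik hkm
  rw [eval_nbrPoly]
  split_ifs with hk
  · exact (IsRelPrime.prod_right fun i hi => isRelPrime_X_sub_X (hne i hi)).mul_dvd (h0 k hk) hprod
  · rwa [one_mul]

theorem IsDescribedBy.sum_mem_span (hA : IsDescribedBy A m M)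
    {θ : Derivation K (MvPolynomial (Fin n) K) (MvPolynomial (Fin n) K)} (hθ : θ ∈ derModule A) :
    ∑ l, θ (X l) ∈ Ideal.span (Set.range (gen K m ∅ M)) := by
  -- Triangular elimination: a multiple of the t-th basis derivation clears θ(x_t) and keeps the
  -- earlier zeros; d counts the remaining coordinates.
  have key : ∀ d t : ℕ, n ≤ t + d → ∀ θ ∈ derModule A, (∀ l : Fin n, (l : ℕ) < t → θ (X l) = 0) →
      ∑ l, θ (X l) ∈ Ideal.span (Set.range (gen K m ∅ M)) := by
    intro d
    induction d with
    | zero =>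
      intro t ht θ _ h
      rw [Finset.sum_eq_zero fun l _ => h l (by omega)]
      exact zero_mem _
    | succ d ih =>
      intro t ht θ hθ h
      by_cases htn : n ≤ t
      · exact ih t (by omega) θ hθ h
      let k : Fin n := ⟨t, by omega⟩
      obtain ⟨q, hq⟩ := hA.eval_nbrPoly_dvd hθ (k := k) h
      have := ih (t + 1) (by omega) (θ - q • basisDer K m M k)
        (sub_mem hθ (Submodule.smul_mem _ q (hA.basisDer_mem k))) fun l hl => by
          rw [Derivation.sub_apply, Derivation.smul_apply, basisDer_X]
          rcases lt_or_eq_of_le (Nat.le_of_lt_succ hl) with hlt | heq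
          · rw [h l hlt, if_neg (not_le.2 (Fin.lt_def.2 hlt)), smul_zero, sub_zero]
          · obtain rfl : l = k := Fin.ext heq
            rw [if_pos le_rfl, hq, smul_eq_mul, mul_comm, sub_self]
      have h2 : ∑ l, θ (X l) =
          ∑ l, (θ - q • basisDer K m M k) (X l) + q * gen K m ∅ M k := by
        rw [← sum_basisDer_X, Finset.mul_sum, ← Finset.sum_add_distrib]
        exact Finset.sum_congr rfl fun l _ => by simp
      rw [h2]
      exact add_mem this (Ideal.mul_mem_left _ _ (Ideal.subset_span (Set.mem_range_self k)))
  exact key n 0 (by omega) θ hθ fun l hl => absurd hl (Nat.not_lt_zero _)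

theorem IsDescribedBy.stIdeal_eq (hA : IsDescribedBy A m M) :
    stIdeal A (fun _ => 1) = Ideal.span (Set.range (gen K m ∅ M)) := by
  have hmap (θ : Derivation K (MvPolynomial (Fin n) K) (MvPolynomial (Fin n) K)) :
      derMap (fun _ => 1) θ = ∑ l, θ (X l) := by simp [derMap]
  apply le_antisymm
  · rintro _ ⟨θ, hθ, rfl⟩
    rw [hmap]
    exact hA.sum_mem_span hθ
  · rw [Ideal.span_le]
    rintro _ ⟨k, rfl⟩
    exact ⟨_, hA.basisDer_mem k, by rw [hmap, sum_basisDer_X]⟩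

end Southwest

end SolomonTerao

theorem mainTheorem3 {K : Type*} [Field K] [CharZero K] (n : ℕ)
    (A : Finset (Submodule K (Fin n → K)))
    (hA : SolomonTerao.IsSouthwest A) (hess : SolomonTerao.IsEssential A) :
    ∃ b : Module.Basis {a : Fin n →₀ ℕ // ∀ i, a i < SolomonTerao.hSeq A i} K
        (SolomonTerao.STAlgebra A (fun _ => 1)),
      ∀ a, b a = Ideal.Quotient.mk (SolomonTerao.stIdeal A (fun _ => 1))
        (MvPolynomial.monomial a.1 1) := by
  obtain ⟨m, M, hm⟩ := hA.exists_isDescribedBy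
  have h := (SolomonTerao.isGood (K := K) m ∅ M).2
  rw [← hm.hSeq_eq, ← hm.stIdeal_eq] at h
  exact h.exists_basis
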